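/- The hedgehog $H_t$ ($t \ge 1$) is the $3$-uniform hypergraph whose vertex set consists of $t$ vertices $1,\dots,t$ (the body) together with $\binom{t}{2}$ further vertices $k_{ij}$, one for each pair $1 \le i < j \le t$, and whose edges are the triples $\{i, j, k_{ij}\}$. Let $r_3(H_t;3)$ be the smallest $n$ such that every $3$-colouring of the edges of the complete $3$-uniform hypergraph on $n$ vertices contains a monochromatic copy of $H_t$. Let $F(t)$ be the smallest $n$ such that every $4$-colouring of the edges of the complete graph $K_n$, in red, blue, green and yellow, contains either a rainbow triangle with one edge in each of red, blue and green, or a clique of order $t$ whose edges receive at most $3$ colours. Then $r_3(H_t;3)$ and $F(t)$ exist (are finite) for every $t \ge 1$, and (i) $r_3(H_t;3) = O(t^4 F(t^3)^2)$, that is, there is a constant $C > 0$ such that $r_3(H_t;3) \le C\, t^4 F(t^3)^2$ for all $t \ge 1$; (ii) $r_3(H_t;3) \ge F(t)$ for all $t \ge 1$. In particular, there is a constant $c > 0$ such that $r_3(H_t;3) \le t^{c \log t}$ for all $t \ge 1$, where $\log$ is the natural logarithm. -/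

import Mathlib

/-- A `k`-uniform hypergraph on the vertex set `V`, given by its set of edges. -/
abbrev UniformHypergraph (V : Type*) (k : ℕ) : Type _ := Set (Set.powersetCard V k)

/-- Every colouring with `q` colours of the edges of the complete `k`-uniform hypergraph on
`n` vertices contains a monochromatic copy of `H`. -/
def RamseyArrows {V : Type*} {k : ℕ} (H : UniformHypergraph V k) (q n : ℕ) : Prop :=
  ∀ χ : Set.powersetCard (Fin n) k → Fin q,
    ∃ (f : V ↪ Fin n) (c : Fin q), ∀ e ∈ H, χ (Set.powersetCard.map k f e) = c

/-- The `q`-colour Ramsey number `r_k(H; q)`. -/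
noncomputable def ramseyNumber {V : Type*} {k : ℕ} (H : UniformHypergraph V k) (q : ℕ) : ℕ :=
  sInf {n : ℕ | RamseyArrows H q n}

/-- The vertices of the hedgehog with body of order `t`: the body `Fin t`, and one further
vertex for every pair of vertices of the body. -/
abbrev HedgehogVertex (t : ℕ) : Type := Fin t ⊕ Set.powersetCard (Fin t) 2

theorem card_hedgehogVertex (t : ℕ) : Nat.card (HedgehogVertex t) = t + t.choose 2 := by
  rw [Nat.card_sum, Set.powersetCard.card]
  simp

/-- The edge `{i, j, k}`, where `k` is the vertex attached to the pair `{i, j}` of the body. -/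
def hedgehogEdge {t : ℕ} (p : Set.powersetCard (Fin t) 2) :
    Set.powersetCard (HedgehogVertex t) 3 :=
  ⟨(p : Finset (Fin t)).disjSum {p}, by
    have h : (p : Finset (Fin t)).card = 2 := p.2
    rw [Set.powersetCard.mem_iff, Finset.card_disjSum, h, Finset.card_singleton]⟩

/-- The `3`-uniform hedgehog `H_t` with body of order `t`. -/
def hedgehog (t : ℕ) : UniformHypergraph (HedgehogVertex t) 3 := Set.range hedgehogEdge

inductive EdgeColour : Type
  | red
  | blue
  | green
  | yellow

/-- A `4`-colouring of the edges of the complete graph `K_n`. -/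
abbrev FourColouring (n : ℕ) : Type := (⊤ : SimpleGraph (Fin n)).edgeSet → EdgeColour

/-- There is a triangle with one edge in each of red, blue and green. -/
def HasRainbowTriangle {n : ℕ} (χ : FourColouring n) : Prop :=
  ∃ (u v w : Fin n) (huv : (⊤ : SimpleGraph (Fin n)).Adj u v)
    (hvw : (⊤ : SimpleGraph (Fin n)).Adj v w) (huw : (⊤ : SimpleGraph (Fin n)).Adj u w),
    χ ⟨s(u, v), huv⟩ = EdgeColour.red ∧ χ ⟨s(v, w), hvw⟩ = EdgeColour.blue ∧
      χ ⟨s(u, w), huw⟩ = EdgeColour.green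

/-- The set of colours that appear on the edges of the clique with vertex set `S`. -/
def cliqueColours {n : ℕ} (χ : FourColouring n) (S : Finset (Fin n)) : Set EdgeColour :=
  {c | ∃ e : (⊤ : SimpleGraph (Fin n)).edgeSet, (∀ v ∈ (e : Sym2 (Fin n)), v ∈ S) ∧ χ e = c}

/-- Every `4`-colouring of the edges of `K_n` contains a red/blue/green rainbow triangle or a
clique of order `t` with at most `3` colours. -/
def RainbowOrClique (t n : ℕ) : Prop :=
  ∀ χ : FourColouring n, HasRainbowTriangle χ ∨
    ∃ S : Finset (Fin n), S.card = t ∧ (cliqueColours χ S).encard ≤ 3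

/-- The function `F(t)`: the smallest `n` with `RainbowOrClique t n`. -/
noncomputable def rainbowF (t : ℕ) : ℕ := sInf {n : ℕ | RainbowOrClique t n}

/-!
Given a `3`-colouring of the triples of an `n`-set, let `G c` be the graph of the pairs lying in
fewer than `t ^ 2` triples of colour `c`. A `t`-set that is independent in `G c` is the body of a
hedgehog of colour `c`, its further vertices being chosen by Hall's theorem. Few triples contain
an edge of the graph of their own colour, so by averaging and deletion some large vertex set has
all its triples independent in one of the three graphs. There, no triangle has its edges in three
different graphs, and the ends of an edge lying in two of the graphs are isolated in the third. If
no independent `t`-set exists, fewer than `3 * t` vertices are isolated in some graph, and without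
them the three graphs are disjoint. Colour their edges red, blue and green, and all other pairs
yellow. A clique of order `t ^ 3` without red, blue or green edges is an independent set of one of
the graphs; one without yellow edges carries a Gallai colouring. Some colour class of a Gallai
colouring with three colours is disconnected, and induction over the parts bounds the order by the
product of the three independence numbers, one of which is therefore at least `t`.

Conversely, a `4`-colouring of pairs without red/blue/green triangles gives each triple a colour
that is absent from its pairs, and the body of a monochromatic hedgehog then misses a colour.

For `F t ≤ t ^ (c * log t)`: without rainbow triangles, any set contains two large subsets between
which one of red, blue and green is sparse, and recursion in both of them produces a set of order
`2 ^ k` which is again at most the product of its three independence numbers.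
-/

section Independence

open SimpleGraph Finset

variable {V V' ι : Type*} {G : SimpleGraph V}

theorem isNIndepSet_map_of_comap {f : V' ↪ V} {S : Finset V'} {n : ℕ}
    (hS : (G.comap f).IsNIndepSet n S) : G.IsNIndepSet n (S.map f) := by
  refine ⟨?_, (card_map f).trans hS.card_eq⟩
  rw [coe_map]
  exact f.injective.injOn.pairwise_image.2 hS.isIndepSet

theorem exists_subset_isNIndepSet {S : Finset V} {m n : ℕ} (hS : G.IsNIndepSet n S) (h : m ≤ n) :
    ∃ T ⊆ S, G.IsNIndepSet m T := by
  obtain ⟨T, hTS, hT⟩ := exists_subset_card_eq (h.trans_eq hS.card_eq.symm)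
  exact ⟨T, hTS, hS.isIndepSet.mono (coe_subset.2 hTS), hT⟩

/-- The independence number of the subgraph of `G` induced on the finite set `W`. -/
noncomputable def indepNumIn (G : SimpleGraph V) (W : Finset V) : ℕ :=
  (G.induce (W : Set V)).indepNum

theorem le_indepNumIn_of_isNIndepSet {W S : Finset V} {n : ℕ} (hSW : S ⊆ W)
    (hS : G.IsNIndepSet n S) : n ≤ indepNumIn G W := by
  classical
  have hind : (G.induce (W : Set V)).IsIndepSet ↑(S.subtype (· ∈ W)) := by
    intro x hx y hy hxy
    exact hS.isIndepSet (mem_subtype.1 hx) (mem_subtype.1 hy) (Subtype.coe_ne_coe.2 hxy)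
  calc n = #(S.subtype (· ∈ W)) := by
        rw [card_subtype, filter_true_of_mem hSW, hS.card_eq]
    _ ≤ indepNumIn G W := hind.card_le_indepNum

theorem exists_isNIndepSet_indepNumIn (G : SimpleGraph V) (W : Finset V) :
    ∃ S ⊆ W, G.IsNIndepSet (indepNumIn G W) S := by
  obtain ⟨S, hS⟩ := (G.induce (W : Set V)).exists_isNIndepSet_indepNum
  exact ⟨S.map (.subtype _), map_subtype_subset S, isNIndepSet_map_of_comap hS⟩

theorem indepNumIn_mono {A B : Finset V} (h : A ⊆ B) : indepNumIn G A ≤ indepNumIn G B := by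
  obtain ⟨S, hSA, hS⟩ := exists_isNIndepSet_indepNumIn G A
  exact le_indepNumIn_of_isNIndepSet (hSA.trans h) hS

theorem indepNumIn_pos {W : Finset V} (hW : W.Nonempty) : 0 < indepNumIn G W := by
  obtain ⟨v, hv⟩ := hW
  exact le_indepNumIn_of_isNIndepSet (singleton_subset_iff.2 hv) ⟨by simp, card_singleton v⟩

theorem indepNumIn_add_le [DecidableEq V] {A B : Finset V} (hAB : Disjoint A B)
    (hG : ∀ a ∈ A, ∀ b ∈ B, ¬ G.Adj a b) :
    indepNumIn G A + indepNumIn G B ≤ indepNumIn G (A ∪ B) := by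
  obtain ⟨S, hSA, hS⟩ := exists_isNIndepSet_indepNumIn G A
  obtain ⟨T, hTB, hT⟩ := exists_isNIndepSet_indepNumIn G B
  refine le_indepNumIn_of_isNIndepSet (union_subset_union hSA hTB) ⟨?_, ?_⟩
  · have : Std.Symm fun v w => ¬ G.Adj v w := ⟨fun _ _ h h' => h h'.symm⟩
    rw [coe_union, IsIndepSet, Set.pairwise_union_of_symm]
    exact ⟨hS.isIndepSet, hT.isIndepSet, fun a ha b hb _ => hG a (hSA ha) b (hTB hb)⟩
  · rw [card_union_of_disjoint (disjoint_of_subset_left hSA (disjoint_of_subset_right hTB hAB)),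
      hS.card_eq, hT.card_eq]

theorem card_union_le_prod_indepNumIn [DecidableEq V] {G : ι → SimpleGraph V} {K : Finset ι}
    {A B : Finset V} {c : ι} (hc : c ∈ K) (hAB : Disjoint A B)
    (hG : ∀ a ∈ A, ∀ b ∈ B, ¬ (G c).Adj a b)
    (hA : #A ≤ ∏ i ∈ K, indepNumIn (G i) A) (hB : #B ≤ ∏ i ∈ K, indepNumIn (G i) B) :
    #(A ∪ B) ≤ ∏ i ∈ K, indepNumIn (G i) (A ∪ B) := by
  classical
  rw [← mul_prod_erase K _ hc] at hA hB ⊢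
  calc #(A ∪ B) ≤ #A + #B := card_union_le A B
    _ ≤ indepNumIn (G c) A * ∏ i ∈ K.erase c, indepNumIn (G i) (A ∪ B) +
        indepNumIn (G c) B * ∏ i ∈ K.erase c, indepNumIn (G i) (A ∪ B) := by
      refine add_le_add (hA.trans ?_) (hB.trans ?_)
      · gcongr
        exact indepNumIn_mono subset_union_left
      · gcongr
        exact indepNumIn_mono subset_union_right
    _ = (indepNumIn (G c) A + indepNumIn (G c) B) *
        ∏ i ∈ K.erase c, indepNumIn (G i) (A ∪ B) := (add_mul ..).symm
    _ ≤ _ := Nat.mul_le_mul_right _ (indepNumIn_add_le hAB hG)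

theorem exists_isNIndepSet_of_pow_le_prod {G : ι → SimpleGraph V} {K : Finset ι}
    (hK : K.Nonempty) {W : Finset V} {t : ℕ} (h : t ^ #K ≤ ∏ i ∈ K, indepNumIn (G i) W) :
    ∃ i ∈ K, ∃ S ⊆ W, (G i).IsNIndepSet t S := by
  obtain ⟨i, hi, hti⟩ : ∃ i ∈ K, t ≤ indepNumIn (G i) W := by
    by_contra! hlt
    have hpos : 0 < t := (hlt _ hK.choose_spec).pos
    have hle := prod_le_pow_card K _ (t - 1) fun i hi => Nat.le_sub_one_of_lt (hlt i hi)
    exact (h.trans hle).not_gt (Nat.pow_lt_pow_left (by lia) hK.card_ne_zero)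
  obtain ⟨S, hSW, hS⟩ := exists_isNIndepSet_indepNumIn (G i) W
  obtain ⟨T, hTS, hT⟩ := exists_subset_isNIndepSet hS hti
  exact ⟨i, hi, T, hTS.trans hSW, hT⟩

end Independence

section Gallai

open SimpleGraph Finset

variable {V V' ι : Type*} {G : ι → SimpleGraph V} {K : Finset ι}

/-- A family of graphs on a common vertex set, thought of as the colour classes of a colouring of
pairs, is rainbow-triangle-free if no triangle has its edges in three different members. Pairs may
lie in several members or in none. -/
def RainbowTriangleFree (G : ι → SimpleGraph V) : Prop :=
  ∀ ⦃a b c⦄, a ≠ b → b ≠ c → a ≠ c → ∀ ⦃u v w⦄,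
    (G a).Adj u v → (G b).Adj v w → ¬ (G c).Adj u w

/-- The members of `G` are the colour classes of a Gallai colouring: an edge colouring of the
complete graph on `V` without rainbow triangles. -/
structure IsGallaiColouring (G : ι → SimpleGraph V) : Prop where
  existsUnique_adj : ∀ ⦃u v⦄, u ≠ v → ∃! i, (G i).Adj u v
  rainbowTriangleFree : RainbowTriangleFree G

theorem RainbowTriangleFree.comap (hG : RainbowTriangleFree G) (f : V' → V) :
    RainbowTriangleFree fun i => (G i).comap f :=
  fun _ _ _ hab hbc hac _ _ _ huv hvw => hG hab hbc hac huv hvw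

namespace IsGallaiColouring

theorem comap (hG : IsGallaiColouring G) (f : V' ↪ V) :
    IsGallaiColouring fun i => (G i).comap f where
  existsUnique_adj _ _ huv := hG.existsUnique_adj (f.injective.ne huv)
  rainbowTriangleFree := hG.rainbowTriangleFree.comap f

theorem eq_of_adj (hG : IsGallaiColouring G) {u v : V} {i j : ι} (hi : (G i).Adj u v)
    (hj : (G j).Adj u v) : i = j :=
  (hG.existsUnique_adj hi.ne).unique hi hj

theorem adj_of_reachable (hG : IsGallaiColouring G) {c d : ι} {x y z : V}
    (hxy : (G c).Reachable x y) (hxz : ¬ (G c).Reachable x z) (hd : (G d).Adj x z) :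
    (G d).Adj y z := by
  obtain ⟨p⟩ := hxy
  induction p with
  | nil => exact hd
  | @cons x u y hxu p ih =>
    have huz : ¬ (G c).Reachable u z := fun h => hxz (hxu.reachable.trans h)
    have huz' : u ≠ z := by rintro rfl; exact huz (.refl u)
    obtain ⟨e, he, -⟩ := hG.existsUnique_adj huz'
    have hec : e ≠ c := by rintro rfl; exact huz he.reachable
    have hdc : d ≠ c := by rintro rfl; exact hxz hd.reachable
    have hed : e = d := by
      by_contra hed
      exact hG.rainbowTriangleFree hec.symm hed hdc.symm hxu he hd
    exact ih huz (hed ▸ he)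

end IsGallaiColouring

theorem exists_adj_reachable_induce_compl {G : SimpleGraph V} (hG : G.Preconnected) {v : V}
    (x : ({v}ᶜ : Set V)) :
    ∃ z : ({v}ᶜ : Set V), G.Adj v z ∧ (G.induce {v}ᶜ).Reachable x z := by
  obtain ⟨p⟩ := hG x v
  obtain ⟨⟨⟨z, w⟩, hzw⟩, -, ⟨hz, hxz⟩, hw⟩ := p.exists_boundary_dart
    {y | ∃ h : y ∈ ({v}ᶜ : Set V), (G.induce {v}ᶜ).Reachable x ⟨y, h⟩} ⟨x.2, .refl _⟩
    fun h => h.1 rfl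
  have hwv : w = v := by
    by_contra hwv
    exact hw ⟨hwv, hxz.trans (Adj.reachable (G := G.induce {v}ᶜ) (v := ⟨w, hwv⟩) hzw)⟩
  exact ⟨⟨z, hz⟩, hwv ▸ hzw.symm, hxz⟩

namespace IsGallaiColouring

theorem adj_of_not_reachable_induce_compl (hG : IsGallaiColouring G) {c d : ι}
    (hc : (G c).Preconnected) {v : V} {x z : ({v}ᶜ : Set V)} (hvx : (G d).Adj v x) (hdc : d ≠ c)
    (hxz : ¬ ((G c).induce {v}ᶜ).Reachable x z) : (G d).Adj x z := by
  obtain ⟨y, hvy, hzy⟩ := exists_adj_reachable_induce_compl hc z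
  have hyx : ¬ ((G c).induce {v}ᶜ).Reachable y x := fun h => hxz (hzy.trans h).symm
  have hyx' : y ≠ x := by rintro rfl; exact hyx (.refl y)
  obtain ⟨e, he, -⟩ := hG.existsUnique_adj (Subtype.coe_ne_coe.2 hyx')
  have hec : e ≠ c := by
    rintro rfl
    exact hyx (Adj.reachable (G := (G e).induce {v}ᶜ) he)
  have hed : d = e := by
    by_contra hde
    exact hG.rainbowTriangleFree hde hec hdc hvx he.symm hvy
  exact ((hG.comap (.subtype _)).adj_of_reachable hzy.symm hyx (hed ▸ he)).symm

theorem preconnected_induce_compl (hG : IsGallaiColouring G) (hK : 2 < #K)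
    (hconn : ∀ i ∈ K, (G i).Preconnected) (v : V) {c : ι} (hc : c ∈ K) :
    ((G c).induce {v}ᶜ).Preconnected := by
  classical
  by_contra hdisc
  obtain ⟨x, y, hxy⟩ : ∃ x y, ¬ ((G c).induce {v}ᶜ).Reachable x y := by
    simpa only [Preconnected, not_forall] using hdisc
  obtain ⟨a, ha, b, hb, hab⟩ : ∃ a ∈ K.erase c, ∃ b ∈ K.erase c, a ≠ b :=
    one_lt_card.1 (by rw [card_erase_of_mem hc]; lia)
  rw [mem_erase] at ha hb
  have : Nontrivial V := ⟨v, x, (ne_of_mem_of_not_mem x.2 (by simp)).symm⟩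
  obtain ⟨p, hp⟩ := (hconn a ha.2).exists_adj_of_nontrivial v
  obtain ⟨q, hq⟩ := (hconn b hb.2).exists_adj_of_nontrivial v
  lift p to ({v}ᶜ : Set V) using hp.ne'
  lift q to ({v}ᶜ : Set V) using hq.ne'
  have hpz {z} := hG.adj_of_not_reachable_induce_compl (hconn c hc) (z := z) hp ha.1
  have hqz {z} := hG.adj_of_not_reachable_induce_compl (hconn c hc) (z := z) hq hb.1
  by_cases hpq : ((G c).induce {v}ᶜ).Reachable p q
  · obtain ⟨z, hz⟩ : ∃ z, ¬ ((G c).induce {v}ᶜ).Reachable p z := by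
      by_contra! h
      exact hxy ((h x).symm.trans (h y))
    have hqa := (hG.comap (.subtype _)).adj_of_reachable hpq hz (hpz hz)
    exact hab (hG.eq_of_adj hqa (hqz fun h => hz (hpq.trans h)))
  · exact hab (hG.eq_of_adj (hpz hpq) (hqz fun h => hpq h.symm).symm)

-- A counterexample stays one when a vertex is deleted.
theorem exists_not_preconnected [Finite V] [Nontrivial V] (hG : IsGallaiColouring G)
    (hK : 2 < #K) : ∃ i ∈ K, ¬ (G i).Preconnected := by
  by_contra! hconn
  induction hn : Nat.card V using Nat.strong_induction_on generalizing V with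
  | _ n ih =>
    obtain ⟨v⟩ : Nonempty V := inferInstance
    obtain ⟨a, ha, b, hb, hab⟩ := one_lt_card.1 (one_lt_two.trans hK)
    obtain ⟨p, hp⟩ := (hconn a ha).exists_adj_of_nontrivial v
    obtain ⟨q, hq⟩ := (hconn b hb).exists_adj_of_nontrivial v
    have hpq : p ≠ q := by rintro rfl; exact hab (hG.eq_of_adj hp hq)
    have : Nontrivial ({v}ᶜ : Set V) :=
      ⟨⟨p, hp.ne'⟩, ⟨q, hq.ne'⟩, fun h => hpq (congrArg Subtype.val h)⟩
    refine ih _ ?_ (hG.comap (.subtype (· ∈ ({v}ᶜ : Set V))))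
      (fun i hi => hG.preconnected_induce_compl hK hconn v hi) rfl
    exact hn ▸ Finite.card_subtype_lt (x := v) (by simp)

end IsGallaiColouring

theorem exists_cut_of_not_preconnected_induce [DecidableEq V] {G : SimpleGraph V} {W : Finset V}
    (hW : ¬ (G.induce (W : Set V)).Preconnected) :
    ∃ A ⊂ W, W \ A ⊂ W ∧ ∀ a ∈ A, ∀ b ∈ W \ A, ¬ G.Adj a b := by
  classical
  obtain ⟨x, y, hxy⟩ : ∃ x y, ¬ (G.induce (W : Set V)).Reachable x y := by
    simpa only [Preconnected, not_forall] using hW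
  let A := {w ∈ W | ∃ h : w ∈ W, (G.induce (W : Set V)).Reachable x ⟨w, h⟩}
  have hxA : x.1 ∈ A := mem_filter.2 ⟨x.2, x.2, .refl _⟩
  have hyA : y.1 ∉ A := fun h => hxy (mem_filter.1 h).2.2
  refine ⟨A, ⟨filter_subset _ _, fun h => hyA (h y.2)⟩,
    sdiff_ssubset (filter_subset _ _) ⟨x, hxA⟩, fun a ha b hb hab => ?_⟩
  obtain ⟨-, haW, hxa⟩ := mem_filter.1 ha
  obtain ⟨hbW, hbA⟩ := mem_sdiff.1 hb
  have hadj : (G.induce (W : Set V)).Adj ⟨a, haW⟩ ⟨b, hbW⟩ := hab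
  exact hbA (mem_filter.2 ⟨hbW, hbW, hxa.trans hadj.reachable⟩)

theorem IsGallaiColouring.card_le_prod_indepNumIn (hG : IsGallaiColouring G) (hK : 2 < #K)
    (W : Finset V) : #W ≤ ∏ i ∈ K, indepNumIn (G i) W := by
  classical
  induction W using Finset.strongInduction with
  | H W ih =>
    rcases le_or_gt #W 1 with hW | hW
    · rcases W.eq_empty_or_nonempty with rfl | hne
      · simp
      · exact hW.trans (prod_pos fun _ _ => indepNumIn_pos hne)
    · have : Nontrivial (W : Set V) := (one_lt_card_iff_nontrivial.1 hW).coe_sort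
      obtain ⟨i, hi, hdisc⟩ :=
        (hG.comap (.subtype (· ∈ (W : Set V)))).exists_not_preconnected hK
      obtain ⟨A, hAW, hBW, hcut⟩ := exists_cut_of_not_preconnected_induce hdisc
      have hunion := card_union_le_prod_indepNumIn hi disjoint_sdiff hcut (ih A hAW) (ih _ hBW)
      rwa [union_sdiff_of_subset hAW.subset] at hunion

end Gallai

section ErdosHajnal

open SimpleGraph Finset

variable {V : Type*}

open Classical in
/-- Every vertex of `A` is adjacent to at most a proportion `1 / q` of `B`. -/
def IsSparsePair (G : SimpleGraph V) (q : ℕ) (A B : Finset V) : Prop :=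
  ∀ a ∈ A, q * #{b ∈ B | G.Adj a b} ≤ #B

theorem isSparsePair_of_not_adj {G : SimpleGraph V} {q : ℕ} {A B : Finset V}
    (h : ∀ a ∈ A, ∀ b ∈ B, ¬ G.Adj a b) : IsSparsePair G q A B := by
  classical
  intro a ha
  simp [filter_eq_empty_iff.2 (h a ha)]

theorem IsSparsePair.mono_left {G : SimpleGraph V} {q : ℕ} {A A' B : Finset V}
    (h : IsSparsePair G q A B) (hA : A' ⊆ A) : IsSparsePair G q A' B :=
  fun a ha => h a (hA ha)

theorem IsSparsePair.exists_large_not_adj {G : SimpleGraph V} {q : ℕ} {W B : Finset V}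
    (h : IsSparsePair G q W B) (hW : 2 * #W ≤ q) :
    ∃ B' ⊆ B, #B ≤ 2 * #B' ∧ ∀ a ∈ W, ∀ b ∈ B', ¬ G.Adj a b := by
  classical
  let N := W.biUnion fun a => {b ∈ B | G.Adj a b}
  have hNB : N ⊆ B := biUnion_subset.2 fun a _ => filter_subset _ _
  have hN : 2 * #N ≤ #B := by
    rcases W.eq_empty_or_nonempty with rfl | hne
    · simp [N]
    refine Nat.le_of_mul_le_mul_left ?_ hne.card_pos
    calc #W * (2 * #N) = 2 * #W * #N := by ring
      _ ≤ q * #N := Nat.mul_le_mul_right _ hW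
      _ ≤ q * ∑ a ∈ W, #{b ∈ B | G.Adj a b} := Nat.mul_le_mul_left _ card_biUnion_le
      _ = ∑ a ∈ W, q * #{b ∈ B | G.Adj a b} := mul_sum ..
      _ ≤ #W * #B := sum_le_card_nsmul _ _ _ fun a ha => by convert h a ha
  refine ⟨B \ N, sdiff_subset, ?_, fun a ha b hb hab => ?_⟩
  · rw [card_sdiff_of_subset hNB]
    lia
  · obtain ⟨hbB, hbN⟩ := mem_sdiff.1 hb
    exact hbN (mem_biUnion.2 ⟨a, ha, mem_filter.2 ⟨hbB, hab⟩⟩)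

theorem exists_three_disjoint_subsets {U : Finset V} {n : ℕ} (hU : 3 * n ≤ #U) :
    ∃ X ⊆ U, ∃ Y ⊆ U, ∃ Z ⊆ U, Disjoint X Y ∧ Disjoint X Z ∧ Disjoint Y Z ∧
      #X = n ∧ #Y = n ∧ #Z = n := by
  classical
  obtain ⟨X, hXU, hX⟩ := exists_subset_card_eq (s := U) (n := n) (by lia)
  obtain ⟨Y, hYU, hY⟩ := exists_subset_card_eq (s := U \ X) (n := n)
    (by rw [card_sdiff_of_subset hXU]; lia)
  obtain ⟨Z, hZU, hZ⟩ := exists_subset_card_eq (s := (U \ X) \ Y) (n := n)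
    (by rw [card_sdiff_of_subset hYU, card_sdiff_of_subset hXU]; lia)
  exact ⟨X, hXU, Y, hYU.trans sdiff_subset, Z, hZU.trans (sdiff_subset.trans sdiff_subset),
    disjoint_sdiff.mono_right hYU, disjoint_sdiff.mono_right (hZU.trans sdiff_subset),
    disjoint_sdiff.mono_right hZU, hX, hY, hZ⟩

variable {G : Fin 3 → SimpleGraph V}

theorem RainbowTriangleFree.exists_isSparsePair (hG : RainbowTriangleFree G) {q p : ℕ}
    (hq : 2 ≤ q) {U : Finset V} (hU : 3 * (q * p) ≤ #U) :
    ∃ i, ∃ A ⊆ U, ∃ B ⊆ U, Disjoint A B ∧ p ≤ #A ∧ p ≤ #B ∧ IsSparsePair (G i) q A B := by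
  classical
  obtain ⟨X, hX, Y, hY, Z, hZ, hXY, hXZ, hYZ, cX, cY, cZ⟩ := exists_three_disjoint_subsets hU
  have hqp : 2 * p ≤ q * p := Nat.mul_le_mul_right p hq
  -- No edge of `G 2` joins the `G 0`-neighbours to the `G 1`-neighbours of a vertex.
  by_cases hv : ∃ v ∈ X, #Y < q * #{y ∈ Y | (G 0).Adj v y} ∧ #Z < q * #{z ∈ Z | (G 1).Adj v z}
  · obtain ⟨v, -, hvY, hvZ⟩ := hv
    rw [cY] at hvY
    rw [cZ] at hvZ
    refine ⟨2, _, (filter_subset _ _).trans hY, _, (filter_subset _ _).trans hZ,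
      disjoint_filter_filter hYZ, (Nat.lt_of_mul_lt_mul_left hvY).le,
      (Nat.lt_of_mul_lt_mul_left hvZ).le, isSparsePair_of_not_adj fun y hy z hz hyz => ?_⟩
    exact hG (a := 0) (b := 2) (c := 1) (by decide) (by decide) (by decide)
      (mem_filter.1 hy).2 hyz (mem_filter.1 hz).2
  push Not at hv
  let A := {v ∈ X | q * #{y ∈ Y | (G 0).Adj v y} ≤ #Y}
  have hAX : A ⊆ X := filter_subset _ _
  rcases le_or_gt p #A with hA | hA
  · exact ⟨0, A, hAX.trans hX, Y, hY, hXY.mono_left hAX, hA, by lia,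
      fun a ha => by convert (mem_filter.1 ha).2⟩
  · refine ⟨1, X \ A, sdiff_subset.trans hX, Z, hZ, hXZ.mono_left sdiff_subset, ?_, by lia,
      fun a ha => ?_⟩
    · rw [card_sdiff_of_subset hAX]
      lia
    · obtain ⟨haX, haA⟩ := mem_sdiff.1 ha
      convert hv a haX (not_le.1 fun h => haA (mem_filter.2 ⟨haX, h⟩))

theorem RainbowTriangleFree.exists_card_le_prod_indepNumIn (hG : RainbowTriangleFree G)
    {q : ℕ} (k : ℕ) (hk : 2 ^ k ≤ q) {U : Finset V} (hU : (6 * q) ^ k ≤ #U) :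
    ∃ W ⊆ U, #W = 2 ^ k ∧ #W ≤ ∏ i, indepNumIn (G i) W := by
  classical
  induction k generalizing U with
  | zero =>
    obtain ⟨x, hx⟩ : U.Nonempty := card_pos.1 (by simpa using hU)
    refine ⟨{x}, singleton_subset_iff.2 hx, by simp, ?_⟩
    exact prod_pos fun _ _ => indepNumIn_pos (singleton_nonempty x)
  | succ k ih =>
    have hk' : 2 * 2 ^ k ≤ q := by rwa [pow_succ'] at hk
    have hq : 2 ≤ q := le_trans (by simp [Nat.one_le_two_pow]) hk'
    obtain ⟨i, A, hAU, B, hBU, hAB, hA, hB, hsparse⟩ :=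
      hG.exists_isSparsePair (p := 2 * (6 * q) ^ k) hq (U := U)
        ((by ring : _ = (6 * q) ^ (k + 1)).trans_le hU)
    obtain ⟨W, hWA, hWcard, hW⟩ := ih (by lia) (U := A) (by lia)
    obtain ⟨B', hB', hcard, hcut⟩ :=
      (hsparse.mono_left hWA).exists_large_not_adj (hWcard ▸ hk')
    obtain ⟨W', hWB, hWcard', hW'⟩ := ih (by lia) (U := B') (by lia)
    have hd : Disjoint W W' := hAB.mono hWA (hWB.trans hB')
    refine ⟨W ∪ W', union_subset (hWA.trans hAU) (hWB.trans (hB'.trans hBU)), ?_,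
      card_union_le_prod_indepNumIn (mem_univ i) hd (fun a ha b hb => hcut a ha b (hWB hb))
        hW hW'⟩
    rw [card_union_of_disjoint hd, hWcard, hWcard', pow_succ, mul_two]

end ErdosHajnal

section UniformHypergraph

open Finset

variable {V : Type*} {H : Finset (Finset V)} {k : ℕ}

theorem sum_card_filter_subset_powersetCard [DecidableEq V] {U : Finset V}
    (hH : H ⊆ U.powersetCard k) {m : ℕ} (hkm : k ≤ m) :
    ∑ S ∈ U.powersetCard m, #{e ∈ H | e ⊆ S} = #H * (#U - k).choose (m - k) := by
  calc ∑ S ∈ U.powersetCard m, #{e ∈ H | e ⊆ S}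
      = ∑ e ∈ H, #{S ∈ U.powersetCard m | e ⊆ S} := by
        simp_rw [card_filter]
        exact sum_comm
    _ = #H * (#U - k).choose (m - k) := sum_const_nat fun e he => by
        obtain ⟨heU, rfl⟩ := mem_powersetCard.1 (hH he)
        exact card_filter_powersetCard_subset e U m heU hkm

theorem exists_mem_powersetCard_card_mul_choose_le [DecidableEq V] {U : Finset V}
    (hH : H ⊆ U.powersetCard k) {m : ℕ} (hm : m ≤ #U) :
    ∃ S ∈ U.powersetCard m, #{e ∈ H | e ⊆ S} * (#U).choose k ≤ #H * m.choose k := by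
  rcases lt_or_ge m k with hmk | hkm
  · obtain ⟨S, hS⟩ := powersetCard_nonempty.2 hm
    refine ⟨S, hS, ?_⟩
    rw [filter_eq_empty_iff.2 fun e he heS => ?_]
    · simp
    · have := card_le_card heS
      rw [(mem_powersetCard.1 (hH he)).2, (mem_powersetCard.1 hS).2] at this
      lia
  obtain ⟨S, hS, hle⟩ : ∃ S ∈ U.powersetCard m,
      #{e ∈ H | e ⊆ S} * (#U).choose m ≤ #H * (#U - k).choose (m - k) := by
    refine exists_le_of_sum_le (powersetCard_nonempty.2 hm) ?_
    rw [← sum_mul, sum_card_filter_subset_powersetCard hH hkm, sum_const, card_powersetCard,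
      smul_eq_mul, mul_comm]
  refine ⟨S, hS, Nat.le_of_mul_le_mul_right ?_
    (Nat.choose_pos (Nat.sub_le_sub_right hm k) : 0 < (#U - k).choose (m - k))⟩
  calc #{e ∈ H | e ⊆ S} * (#U).choose k * (#U - k).choose (m - k)
      = #{e ∈ H | e ⊆ S} * (#U).choose m * m.choose k := by
        rw [mul_assoc, ← Nat.choose_mul hkm, mul_assoc]
    _ ≤ #H * (#U - k).choose (m - k) * m.choose k := Nat.mul_le_mul_right _ hle
    _ = #H * m.choose k * (#U - k).choose (m - k) := by ring

theorem exists_subset_forall_not_subset [DecidableEq V] (hH : ∀ e ∈ H, e.Nonempty)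
    (S : Finset V) :
    ∃ T ⊆ S, #S ≤ #T + #{e ∈ H | e ⊆ S} ∧ ∀ e ∈ H, ¬ e ⊆ T := by
  choose g hg using hH
  let D := {e ∈ H | e ⊆ S}.attach.image fun e => g e.1 (mem_filter.1 e.2).1
  refine ⟨S \ D, sdiff_subset, ?_, fun e he heT => ?_⟩
  · have hD : #D ≤ #{e ∈ H | e ⊆ S} := card_image_le.trans_eq card_attach
    have := le_card_sdiff D S
    lia
  · refine (mem_sdiff.1 (heT (hg e he))).2 (mem_image.2 ⟨⟨e, ?_⟩, mem_attach _ _, rfl⟩)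
    exact mem_filter.2 ⟨he, heT.trans sdiff_subset⟩

theorem six_mul_choose_three_le (n : ℕ) : 6 * n.choose 3 ≤ n ^ 3 := by
  have h := Nat.descFactorial_eq_factorial_mul_choose n 3
  exact h.symm.trans_le (Nat.descFactorial_le_pow n 3)

theorem sub_two_pow_three_le_six_mul_choose_three (n : ℕ) : (n - 2) ^ 3 ≤ 6 * n.choose 3 := by
  have h := Nat.descFactorial_eq_factorial_mul_choose n 3
  exact (Nat.pow_sub_le_descFactorial n 3).trans_eq h

theorem exists_card_eq_forall_not_subset [Fintype V] (hH : ∀ e ∈ H, #e = 3) {D s : ℕ}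
    (hHD : #H ≤ D * Fintype.card V ^ 2) (hD : 0 < D)
    (hN : 32 * D * s ^ 2 + 4 ≤ Fintype.card V) :
    ∃ T : Finset V, #T = s ∧ ∀ e ∈ H, ¬ e ⊆ T := by
  classical
  obtain ⟨n, hn⟩ : ∃ n, Fintype.card V = n + 2 := ⟨Fintype.card V - 2, by lia⟩
  rw [hn] at hHD hN
  have hsn : 2 * s ≤ n := by nlinarith [Nat.le_self_pow two_ne_zero s]
  -- A set of order `2 * s` contains at most `s` members of `H` on average, all of which can be
  -- destroyed by deleting `s` vertices.
  obtain ⟨S, hS, havg⟩ := exists_mem_powersetCard_card_mul_choose_le (U := univ) (m := 2 * s)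
    (fun e he => mem_powersetCard.2 ⟨subset_univ e, hH e he⟩) (by rw [card_univ]; lia)
  obtain ⟨T, -, hT, hind⟩ := exists_subset_forall_not_subset
    (fun e he => card_pos.1 (by rw [hH e he]; norm_num)) S
  have hfew : #{e ∈ H | e ⊆ S} ≤ s := by
    refine Nat.le_of_mul_le_mul_right ?_ (pow_pos (by lia : 0 < n) 3)
    calc #{e ∈ H | e ⊆ S} * n ^ 3
        ≤ #{e ∈ H | e ⊆ S} * (6 * (n + 2).choose 3) :=
          Nat.mul_le_mul_left _ (sub_two_pow_three_le_six_mul_choose_three (n + 2))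
      _ = 6 * (#{e ∈ H | e ⊆ S} * (n + 2).choose 3) := by ring
      _ ≤ 6 * (#H * (2 * s).choose 3) := by
          rw [card_univ, hn] at havg
          exact Nat.mul_le_mul_left 6 havg
      _ = #H * (6 * (2 * s).choose 3) := by ring
      _ ≤ D * (2 * n) ^ 2 * (2 * s) ^ 3 :=
          Nat.mul_le_mul (hHD.trans (by gcongr; lia)) (six_mul_choose_three_le _)
      _ = s * (32 * D * s ^ 2) * n ^ 2 := by ring
      _ ≤ s * n * n ^ 2 := by gcongr; lia
      _ = s * n ^ 3 := by ring
  have hsT : s ≤ #T := by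
    rw [(mem_powersetCard.1 hS).2] at hT
    lia
  obtain ⟨T', hT', hcard⟩ := exists_subset_card_eq hsT
  exact ⟨T', hcard, fun e he heT => hind e he (heT.trans hT')⟩

end UniformHypergraph

section Codegree

open SimpleGraph Finset

variable {V V' ι : Type*}

/-- Every three vertices are independent in some member of the family `G`. -/
def EveryTripleIndep (G : ι → SimpleGraph V) : Prop :=
  ∀ ⦃u v w⦄, u ≠ v → v ≠ w → u ≠ w →
    ∃ i, ¬ (G i).Adj u v ∧ ¬ (G i).Adj v w ∧ ¬ (G i).Adj u w

theorem EveryTripleIndep.comap {G : ι → SimpleGraph V} (hG : EveryTripleIndep G) (f : V' ↪ V) :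
    EveryTripleIndep fun i => (G i).comap f :=
  fun _ _ _ huv hvw huw => hG (f.injective.ne huv) (f.injective.ne hvw) (f.injective.ne huw)

theorem EveryTripleIndep.exists_isIndepSet {G : ι → SimpleGraph V} (hG : EveryTripleIndep G)
    {e : Finset V} (he : #e = 3) : ∃ i, (G i).IsIndepSet e := by
  classical
  obtain ⟨u, v, w, huv, huw, hvw, rfl⟩ := card_eq_three.1 he
  obtain ⟨i, h⟩ := hG huv hvw huw
  refine ⟨i, ?_⟩
  simp only [IsIndepSet, Set.Pairwise, mem_coe, mem_insert, mem_singleton]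
  grind [SimpleGraph.adj_comm, SimpleGraph.irrefl]

theorem EveryTripleIndep.rainbowTriangleFree {G : Fin 3 → SimpleGraph V}
    (hG : EveryTripleIndep G) : RainbowTriangleFree G := by
  intro a b c hab hbc hac u v w huv hvw huw
  obtain ⟨i, hiuv, hivw, hiuw⟩ := hG huv.ne hvw.ne huw.ne
  obtain rfl | rfl | rfl : i = a ∨ i = b ∨ i = c := by lia
  exacts [hiuv huv, hivw hvw, hiuw huw]

variable [Fintype V] [DecidableEq V]

open Classical in
/-- The vertices that complete `p` to a triple of colour `c`. -/
noncomputable def colourLink (χ : Set.powersetCard V 3 → ι) (c : ι) (p : Finset V) : Finset V :=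
  {w | ∃ h : #(insert w p) = 3, χ ⟨insert w p, h⟩ = c}

theorem mem_colourLink {χ : Set.powersetCard V 3 → ι} {c : ι} {p : Finset V} {w : V} :
    w ∈ colourLink χ c p ↔ ∃ h : #(insert w p) = 3, χ ⟨insert w p, h⟩ = c := by
  simp [colourLink]

/-- The pairs that lie in fewer than `T` triples of colour `c`. -/
def lowCodegreeGraph (χ : Set.powersetCard V 3 → ι) (c : ι) (T : ℕ) : SimpleGraph V where
  Adj u v := u ≠ v ∧ #(colourLink χ c {u, v}) < T
  symm := ⟨fun u v h => ⟨h.1.symm, pair_comm u v ▸ h.2⟩⟩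
  loopless := ⟨fun _ h => h.1 rfl⟩

theorem le_card_colourLink_of_isIndepSet {χ : Set.powersetCard V 3 → ι} {c : ι} {T : ℕ}
    {S p : Finset V} (hS : (lowCodegreeGraph χ c T).IsIndepSet S) (hp : #p = 2) (hpS : p ⊆ S) :
    T ≤ #(colourLink χ c p) := by
  obtain ⟨u, v, huv, rfl⟩ := card_eq_two.1 hp
  by_contra! hlt
  exact hS (hpS (by simp)) (hpS (by simp)) huv ⟨huv, hlt⟩

open Classical in
theorem card_not_isIndepSet_lowCodegreeGraph_le [Fintype ι] (χ : Set.powersetCard V 3 → ι)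
    (T : ℕ) :
    #{e : Finset V | #e = 3 ∧ ∀ c, ¬ (lowCodegreeGraph χ c T).IsIndepSet e} ≤
      Fintype.card ι * T * Fintype.card V ^ 2 := by
  let I : Finset (ι × V × V) := {x | #(colourLink χ x.1 {x.2.1, x.2.2}) < T}
  let f (x : ι × V × V) : Finset (Finset V) :=
    (colourLink χ x.1 {x.2.1, x.2.2}).image (insert · {x.2.1, x.2.2})
  have hI : #(I.biUnion f) ≤ Fintype.card ι * T * Fintype.card V ^ 2 :=
    calc #(I.biUnion f) ≤ #I * T := card_biUnion_le_card_mul _ _ _ fun x hx =>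
          card_image_le.trans (mem_filter.1 hx).2.le
      _ ≤ Fintype.card (ι × V × V) * T := Nat.mul_le_mul_right _ (card_le_univ I)
      _ = Fintype.card ι * T * Fintype.card V ^ 2 := by
          simp only [Fintype.card_prod]
          ring
  refine (card_le_card fun e he => ?_).trans hI
  obtain ⟨hcard, hlow⟩ := (mem_filter.1 he).2
  obtain ⟨u, hu, v, hv, huv, hadj⟩ : ∃ u ∈ e, ∃ v ∈ e, u ≠ v ∧
      (lowCodegreeGraph χ (χ ⟨e, hcard⟩) T).Adj u v := by
    simpa [IsIndepSet, Set.Pairwise] using hlow (χ ⟨e, hcard⟩)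
  have hpair : {u, v} ⊆ e := by simp [insert_subset_iff, hu, hv]
  obtain ⟨w, hw⟩ : ∃ w, e \ {u, v} = {w} := by
    rw [← card_eq_one, card_sdiff_of_subset hpair, hcard, card_pair huv]
  obtain rfl : insert w {u, v} = e := by
    rw [← singleton_union, ← hw, sdiff_union_of_subset hpair]
  refine mem_biUnion.2 ⟨(χ ⟨_, hcard⟩, u, v), mem_filter.2 ⟨mem_univ _, hadj.2⟩, ?_⟩
  exact mem_image_of_mem _ (mem_colourLink.2 ⟨hcard, rfl⟩)

theorem exists_everyTripleIndep_lowCodegreeGraph [Fintype ι] [Nonempty ι]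
    (χ : Set.powersetCard V 3 → ι) {T s : ℕ} (hT : 0 < T)
    (hV : 32 * (Fintype.card ι * T) * s ^ 2 + 4 ≤ Fintype.card V) :
    ∃ S : Finset V, #S = s ∧
      EveryTripleIndep fun c => (lowCodegreeGraph χ c T).induce (S : Set V) := by
  classical
  obtain ⟨S, hS, hind⟩ := exists_card_eq_forall_not_subset (fun e he => (mem_filter.1 he).2.1)
    (card_not_isIndepSet_lowCodegreeGraph_le χ T) (mul_pos Fintype.card_pos hT) hV
  refine ⟨S, hS, fun u v w huv hvw huw => ?_⟩
  have hcard : #{u.1, v.1, w.1} = 3 := card_eq_three.2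
    ⟨_, _, _, Subtype.coe_ne_coe.2 huv, Subtype.coe_ne_coe.2 huw, Subtype.coe_ne_coe.2 hvw, rfl⟩
  obtain ⟨c, hc⟩ : ∃ c, (lowCodegreeGraph χ c T).IsIndepSet ↑({u.1, v.1, w.1} : Finset V) := by
    by_contra! hnot
    refine hind _ (mem_filter.2 ⟨mem_univ _, hcard, hnot⟩) ?_
    simp only [insert_subset_iff, singleton_subset_iff]
    exact ⟨u.2, v.2, w.2⟩
  exact ⟨c, hc (by simp) (by simp) (Subtype.coe_ne_coe.2 huv),
    hc (by simp) (by simp) (Subtype.coe_ne_coe.2 hvw),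
    hc (by simp) (by simp) (Subtype.coe_ne_coe.2 huw)⟩

end Codegree

section Embedding

open SimpleGraph Finset

variable {V ι : Type*}

theorem exists_injective_forall_mem_of_card_le [Fintype ι] {A : ι → Finset V}
    (hA : ∀ i, Fintype.card ι ≤ #(A i)) : ∃ f : ι → V, f.Injective ∧ ∀ i, f i ∈ A i := by
  classical
  refine (all_card_le_biUnion_card_iff_exists_injective A).1 fun s => ?_
  rcases s.eq_empty_or_nonempty with rfl | ⟨i, hi⟩
  · simp
  · exact (card_le_univ s).trans ((hA i).trans (card_le_card (subset_biUnion_of_mem A hi)))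

theorem exists_hedgehog_of_isNIndepSet_lowCodegreeGraph [Fintype V] [DecidableEq V]
    {χ : Set.powersetCard V 3 → ι} {c : ι} {t T : ℕ} (hT : t + t.choose 2 ≤ T) {S : Finset V}
    (hS : (lowCodegreeGraph χ c T).IsNIndepSet t S) :
    ∃ f : HedgehogVertex t ↪ V, ∀ e ∈ hedgehog t, χ (Set.powersetCard.map 3 f e) = c := by
  let g : Fin t ↪ V :=
    (S.equivFinOfCardEq hS.card_eq).symm.toEmbedding.trans (Function.Embedding.subtype _)
  have hg (i) : g i ∈ S := ((S.equivFinOfCardEq hS.card_eq).symm i).2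
  let A (p : Set.powersetCard (Fin t) 2) := colourLink χ c (p.1.map g) \ S
  have hA (p) : Fintype.card (Set.powersetCard (Fin t) 2) ≤ #(A p) := by
    have hlink : T ≤ #(colourLink χ c (p.1.map g)) :=
      le_card_colourLink_of_isIndepSet hS.isIndepSet ((card_map g).trans p.2) fun x hx => by
        obtain ⟨i, -, rfl⟩ := mem_map.1 hx
        exact hg i
    have hdiff := le_card_sdiff S (colourLink χ c (p.1.map g))
    rw [← Nat.card_eq_fintype_card, Set.powersetCard.card, Nat.card_fin]
    rw [hS.card_eq] at hdiff
    lia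
  obtain ⟨k, hk, hkA⟩ := exists_injective_forall_mem_of_card_le hA
  have hkS (p) : k p ∉ S := (mem_sdiff.1 (hkA p)).2
  let f : HedgehogVertex t ↪ V :=
    ⟨Sum.elim g k, g.injective.sumElim hk fun i p h => hkS p (h ▸ hg i)⟩
  refine ⟨f, ?_⟩
  rintro _ ⟨p, rfl⟩
  obtain ⟨h3, hc⟩ := mem_colourLink.1 (mem_sdiff.1 (hkA p)).1
  rw [← hc]
  congr 1
  ext x
  simp [hedgehogEdge, f, Set.powersetCard.map, or_comm, eq_comm]

end Embedding

section FourColouring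

open SimpleGraph Finset

/-- Red, blue and green are numbered `0`, `1`, `2`; yellow is singled out as `none`. -/
def edgeColourEquiv : EdgeColour ≃ Option (Fin 3) where
  toFun
    | .red => some 0
    | .blue => some 1
    | .green => some 2
    | .yellow => none
  invFun
    | some 0 => .red
    | some 1 => .blue
    | some 2 => .green
    | none => .yellow
  left_inv c := by cases c <;> rfl
  right_inv c := by rcases c with _ | c <;> [rfl; (fin_cases c <;> rfl)]

namespace FourColouring

variable {n : ℕ}

/-- The colour classes of `χ`, in the numbering of `edgeColourEquiv`. -/
def graph (χ : FourColouring n) (c : Option (Fin 3)) : SimpleGraph (Fin n) :=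
  EdgeLabeling.labelGraph (G := ⊤) χ (edgeColourEquiv.symm c)

variable {χ : FourColouring n}

theorem graph_adj {c : Option (Fin 3)} {u v : Fin n} :
    (χ.graph c).Adj u v ↔ ∃ h : u ≠ v, χ ⟨s(u, v), h⟩ = edgeColourEquiv.symm c :=
  EdgeLabeling.labelGraph_adj u v

theorem graph_adj_unique {c d : Option (Fin 3)} {u v : Fin n} (hc : (χ.graph c).Adj u v)
    (hd : (χ.graph d).Adj u v) : c = d := by
  obtain ⟨_, hc⟩ := graph_adj.1 hc
  obtain ⟨_, hd⟩ := graph_adj.1 hd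
  exact edgeColourEquiv.symm.injective (hc.symm.trans hd)

theorem exists_graph_adj (χ : FourColouring n) {u v : Fin n} (huv : u ≠ v) :
    ∃ c, (χ.graph c).Adj u v :=
  ⟨edgeColourEquiv (χ ⟨s(u, v), huv⟩), graph_adj.2 ⟨huv, by simp⟩⟩

theorem exists_graph_some_eq {G : Fin 3 → SimpleGraph (Fin n)}
    (hG : Pairwise fun i j => Disjoint (G i) (G j)) :
    ∃ χ : FourColouring n, ∀ i, χ.graph (some i) = G i := by
  classical
  have huniq {i j u v} (hi : (G i).Adj u v) (hj : (G j).Adj u v) : i = j :=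
    hG.eq fun hdisj => disjoint_left.1 hdisj _ _ hi hj
  let χ : FourColouring n := fun e =>
    edgeColourEquiv.symm (if h : ∃ i, e.1 ∈ (G i).edgeSet then some h.choose else none)
  refine ⟨χ, fun i => ?_⟩
  ext u v
  rw [graph_adj]
  simp only [χ, EmbeddingLike.apply_eq_iff_eq, mem_edgeSet]
  constructor
  · rintro ⟨_, h⟩
    by_cases hex : ∃ i, (G i).Adj u v
    · rw [dif_pos hex, Option.some_inj] at h
      exact h ▸ hex.choose_spec
    · simp [dif_neg hex] at h
  · intro h
    have hex : ∃ i, (G i).Adj u v := ⟨i, h⟩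
    exact ⟨h.ne, by rw [dif_pos hex, huniq hex.choose_spec h]⟩

theorem hasRainbowTriangle_iff : HasRainbowTriangle χ ↔ ∃ u v w,
    (χ.graph (some 0)).Adj u v ∧ (χ.graph (some 1)).Adj v w ∧ (χ.graph (some 2)).Adj u w := by
  simp only [HasRainbowTriangle, graph_adj]
  constructor
  · rintro ⟨u, v, w, huv, hvw, huw, h0, h1, h2⟩
    exact ⟨u, v, w, ⟨huv, h0⟩, ⟨hvw, h1⟩, ⟨huw, h2⟩⟩
  · rintro ⟨u, v, w, ⟨huv, h0⟩, ⟨hvw, h1⟩, ⟨huw, h2⟩⟩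
    exact ⟨u, v, w, huv, hvw, huw, h0, h1, h2⟩

theorem mem_cliqueColours_iff {S : Finset (Fin n)} {c : Option (Fin 3)} :
    edgeColourEquiv.symm c ∈ cliqueColours χ S ↔ ¬ (χ.graph c).IsIndepSet S := by
  simp only [cliqueColours, Set.mem_ofPred_eq, IsIndepSet, Set.Pairwise, graph_adj, not_forall,
    not_not, Subtype.exists, Sym2.exists, Sym2.mem_iff, forall_eq_or_imp, forall_eq]
  constructor
  · rintro ⟨u, v, huv, ⟨hu, hv⟩, h⟩
    exact ⟨u, hu, v, hv, huv, huv, h⟩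
  · rintro ⟨u, hu, v, hv, huv, _, h⟩
    exact ⟨u, v, huv, ⟨hu, hv⟩, h⟩

theorem encard_cliqueColours_le_three_iff {S : Finset (Fin n)} :
    (cliqueColours χ S).encard ≤ 3 ↔ ∃ c, (χ.graph c).IsIndepSet S := by
  have : Finite EdgeColour := .of_equiv _ edgeColourEquiv.symm
  have hfour : ENat.card EdgeColour = 3 + 1 := by
    simp [ENat.card_congr edgeColourEquiv, three_add_one_eq_four]
  have hcard : (cliqueColours χ S).encard ≤ 3 ↔ cliqueColours χ S ≠ Set.univ := by
    rw [← ENat.lt_add_one_iff (by simp), ← hfour]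
    refine ⟨?_, (Set.toFinite _).encard_lt_card⟩
    rintro h huniv
    simp [huniv] at h
  rw [hcard, Set.ne_univ_iff_exists_notMem, edgeColourEquiv.exists_congr_left]
  simp only [mem_cliqueColours_iff, not_not]

theorem everyTripleIndep_iff :
    (EveryTripleIndep fun i => χ.graph (some i)) ↔ ¬ HasRainbowTriangle χ := by
  rw [hasRainbowTriangle_iff]
  constructor
  · rintro hχ ⟨u, v, w, h0, h1, h2⟩
    exact hχ.rainbowTriangleFree (by decide) (by decide) (by decide) h0 h1 h2
  · intro hχ u v w _ _ _
    by_contra! hcover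
    have huniq {c d x y} := @graph_adj_unique n χ c d x y
    have h0 := hcover 0
    have h1 := hcover 1
    have h2 := hcover 2
    grind [SimpleGraph.adj_comm]

end FourColouring

theorem rainbowOrClique_iff {t n : ℕ} : RainbowOrClique t n ↔ ∀ χ : FourColouring n,
    (EveryTripleIndep fun i => χ.graph (some i)) → ∃ c S, (χ.graph c).IsNIndepSet t S := by
  refine forall_congr' fun χ => ?_
  simp only [FourColouring.encard_cliqueColours_le_three_iff, FourColouring.everyTripleIndep_iff,
    or_iff_not_imp_left, isNIndepSet_iff]
  refine imp_congr_right fun _ => ⟨?_, ?_⟩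
  · rintro ⟨S, hS, c, hc⟩
    exact ⟨c, S, hc, hS⟩
  · rintro ⟨c, S, hc, hS⟩
    exact ⟨S, hS, c, hc⟩

theorem RainbowOrClique.le {t n : ℕ} (h : RainbowOrClique t n) : t ≤ n := by
  obtain ⟨χ, hχ⟩ := FourColouring.exists_graph_some_eq (G := fun _ => (⊥ : SimpleGraph (Fin n)))
    fun _ _ _ => disjoint_bot_left
  obtain ⟨c, S, hS⟩ := rainbowOrClique_iff.1 h χ fun u v w _ _ _ => ⟨0, by simp [hχ]⟩
  simpa [hS.card_eq] using card_le_univ S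

theorem RamseyArrows.rainbowOrClique {t n : ℕ} (h : RamseyArrows (hedgehog t) 3 n) :
    RainbowOrClique t n := by
  rw [rainbowOrClique_iff]
  intro χ hχ
  choose ψ hψ using fun e : Set.powersetCard (Fin n) 3 => hχ.exists_isIndepSet e.2
  obtain ⟨f, c, hf⟩ := h ψ
  refine ⟨some c, univ.map (Function.Embedding.inl.trans f), ?_, by simp⟩
  rw [coe_map, coe_univ, Set.image_univ]
  rintro _ ⟨i, rfl⟩ _ ⟨j, rfl⟩ hij
  let p : Set.powersetCard (Fin t) 2 := ⟨{i, j}, card_pair (by rintro rfl; exact hij rfl)⟩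
  have hind := hψ (Set.powersetCard.map 3 f (hedgehogEdge p))
  rw [hf _ ⟨p, rfl⟩] at hind
  exact hind (by simp [Set.powersetCard.map, hedgehogEdge, p])
    (by simp [Set.powersetCard.map, hedgehogEdge, p]) hij

theorem rainbowOrClique_of_pow_le {t k n : ℕ} (ht : t ^ 3 ≤ 2 ^ k) (hn : (6 * 2 ^ k) ^ k ≤ n) :
    RainbowOrClique t n := by
  rw [rainbowOrClique_iff]
  intro χ hχ
  obtain ⟨W, -, hW, hprod⟩ := hχ.rainbowTriangleFree.exists_card_le_prod_indepNumIn k le_rfl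
    (U := univ) (by simpa using hn)
  obtain ⟨i, -, S, -, hS⟩ := exists_isNIndepSet_of_pow_le_prod
    (K := (univ : Finset (Fin 3))) univ_nonempty ((ht.trans_eq hW.symm).trans hprod)
  exact ⟨some i, S, hS⟩

end FourColouring

section UpperBound

open SimpleGraph Finset

theorem EveryTripleIndep.exists_isIsolated {V : Type*} {G : Fin 3 → SimpleGraph V}
    (hG : EveryTripleIndep G) (hV : 2 < ENat.card V) {i j : Fin 3} (hij : i ≠ j) {u v : V}
    (hi : (G i).Adj u v) (hj : (G j).Adj u v) : ∃ k, (G k).IsIsolated u := by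
  have hmissing {w : V} (hwu : u ≠ w) (hwv : v ≠ w) :
      ∃ k, k ≠ i ∧ k ≠ j ∧ ¬ (G k).Adj u v ∧ ¬ (G k).Adj u w := by
    obtain ⟨k, hkuv, -, hkuw⟩ := hG hi.ne hwv hwu
    exact ⟨k, fun h => hkuv (h ▸ hi), fun h => hkuv (h ▸ hj), hkuv, hkuw⟩
  obtain ⟨x, hx⟩ : ∃ x, x ∉ ({u, v} : Set V) := by
    by_contra! hall
    rw [← Set.encard_univ, ← Set.eq_univ_of_forall hall, Set.encard_pair hi.ne] at hV
    exact hV.false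
  obtain ⟨hxu, hxv⟩ : x ≠ u ∧ x ≠ v := by simpa using hx
  obtain ⟨k, hki, hkj, hkuv, -⟩ := hmissing hxu.symm hxv.symm
  refine ⟨k, fun w hw => ?_⟩
  have hwv : v ≠ w := by rintro rfl; exact hkuv hw
  obtain ⟨l, hli, hlj, -, hluw⟩ := hmissing hw.ne hwv
  obtain rfl : l = k := by lia
  exact hluw hw

theorem EveryTripleIndep.exists_pairwise_disjoint_comap {V : Type*} [Fintype V]
    {G : Fin 3 → SimpleGraph V} (hG : EveryTripleIndep G) {t m : ℕ}
    (hV : m + 3 * t ≤ Fintype.card V) (hindep : ∀ i S, ¬ (G i).IsNIndepSet t S) :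
    ∃ f : Fin m ↪ V, Pairwise fun i j => Disjoint ((G i).comap f) ((G j).comap f) := by
  classical
  have ht : t ≠ 0 := by
    rintro rfl
    exact hindep 0 ∅ ⟨by simp, card_empty⟩
  let I (i : Fin 3) : Finset V := {v | (G i).IsIsolated v}
  have hI (i : Fin 3) : #(I i) ≤ t := by
    by_contra! hlt
    have hind : (G i).IsNIndepSet #(I i) (I i) :=
      ⟨fun u hu v _ _ => (mem_filter.1 hu).2 v, rfl⟩
    obtain ⟨S, -, hS⟩ := exists_subset_isNIndepSet hind hlt.le
    exact hindep i S hS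
  have hunion : #(univ.biUnion I) ≤ 3 * t := by
    simpa using card_biUnion_le_card_mul univ I t fun i _ => hI i
  obtain ⟨W, hWI, hW⟩ := exists_subset_card_eq (s := (univ.biUnion I)ᶜ) (n := m)
    (by rw [card_compl]; lia)
  refine ⟨(W.equivFinOfCardEq hW).symm.toEmbedding.trans (.subtype _), fun i j hij =>
    disjoint_left.2 fun x y hi hj => ?_⟩
  have hV2 : 2 < ENat.card V := by
    rw [ENat.card_eq_coe_fintype_card]
    exact_mod_cast (by lia : 2 < Fintype.card V)
  obtain ⟨k, hk⟩ := hG.exists_isIsolated hV2 hij hi hj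
  refine mem_compl.1 (hWI ((W.equivFinOfCardEq hW).symm x).2) ?_
  exact mem_biUnion.2 ⟨k, mem_univ _, mem_filter.2 ⟨mem_univ _, hk⟩⟩

theorem RainbowOrClique.exists_isNIndepSet {t n : ℕ} (h : RainbowOrClique (t ^ 3) n)
    {G : Fin 3 → SimpleGraph (Fin n)} (hG : EveryTripleIndep G)
    (hdisj : Pairwise fun i j => Disjoint (G i) (G j)) :
    ∃ i S, (G i).IsNIndepSet t S := by
  obtain ⟨χ, hχ⟩ := FourColouring.exists_graph_some_eq hdisj
  obtain ⟨_ | i, S, hS⟩ := rainbowOrClique_iff.1 h χ (by simpa only [hχ] using hG)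
  · have hgallai : IsGallaiColouring fun i => (G i).induce (S : Set (Fin n)) := by
      refine ⟨fun u v huv => ?_, hG.rainbowTriangleFree.comap _⟩
      obtain ⟨_ | i, hi⟩ := χ.exists_graph_adj (Subtype.coe_ne_coe.2 huv)
      · exact (hS.isIndepSet u.2 v.2 (Subtype.coe_ne_coe.2 huv) hi).elim
      · rw [hχ] at hi
        exact ⟨i, hi, fun j hj => hdisj.eq fun h => disjoint_left.1 h _ _ hj hi⟩
    have hcard : #(univ : Finset (S : Set (Fin n))) = t ^ 3 := by simpa using hS.card_eq
    obtain ⟨i, -, T, -, hT⟩ := exists_isNIndepSet_of_pow_le_prod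
      (K := (univ : Finset (Fin 3))) univ_nonempty
      (hcard.symm.trans_le (hgallai.card_le_prod_indepNumIn (by simp) univ))
    exact ⟨i, _, isNIndepSet_map_of_comap hT⟩
  · obtain ⟨T, -, hT⟩ := exists_subset_isNIndepSet hS (Nat.le_self_pow three_ne_zero t)
    exact ⟨i, T, hχ i ▸ hT⟩

theorem RainbowOrClique.exists_isNIndepSet_of_card_le {V : Type*} [Fintype V] {t m : ℕ}
    (h : RainbowOrClique (t ^ 3) m) {G : Fin 3 → SimpleGraph V} (hG : EveryTripleIndep G)
    (hV : m + 3 * t ≤ Fintype.card V) : ∃ i S, (G i).IsNIndepSet t S := by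
  by_contra! hindep
  obtain ⟨f, hdisj⟩ := hG.exists_pairwise_disjoint_comap hV hindep
  obtain ⟨i, S, hS⟩ := h.exists_isNIndepSet (hG.comap f) hdisj
  exact hindep i _ (isNIndepSet_map_of_comap hS)

theorem RainbowOrClique.ramseyArrows {t m n : ℕ} (h : RainbowOrClique (t ^ 3) m) (ht : 1 ≤ t)
    (hn : 96 * t ^ 2 * (m + 3 * t) ^ 2 + 4 ≤ n) : RamseyArrows (hedgehog t) 3 n := by
  intro χ
  obtain ⟨S, hS, htriple⟩ := exists_everyTripleIndep_lowCodegreeGraph χ (T := t ^ 2)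
    (s := m + 3 * t) (by positivity) (by simpa [← mul_assoc] using hn)
  obtain ⟨c, T, hT⟩ := h.exists_isNIndepSet_of_card_le htriple (by simp [hS])
  have hcodeg : t + t.choose 2 ≤ t ^ 2 :=
    calc t + t.choose 2 ≤ t + t * (t - 1) := by
          rw [Nat.choose_two_right]
          gcongr
          exact Nat.div_le_self _ _
      _ = t ^ 2 := by
          obtain ⟨s, rfl⟩ := Nat.exists_eq_add_of_le' ht
          rw [Nat.add_sub_cancel]
          ring
  obtain ⟨f, hf⟩ :=
    exists_hedgehog_of_isNIndepSet_lowCodegreeGraph hcodeg (isNIndepSet_map_of_comap hT)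
  exact ⟨f, c, hf⟩

end UpperBound

section Bounds

theorem exists_rainbowOrClique (t : ℕ) : ∃ n, RainbowOrClique t n :=
  ⟨_, rainbowOrClique_of_pow_le (Nat.lt_two_pow_self (n := t ^ 3)).le le_rfl⟩

theorem isLeast_rainbowF (t : ℕ) : IsLeast {n | RainbowOrClique t n} (rainbowF t) :=
  ⟨Nat.sInf_mem (exists_rainbowOrClique t), fun _ hn => Nat.sInf_le hn⟩

theorem isLeast_ramseyNumber_hedgehog {t : ℕ} (ht : 1 ≤ t) :
    IsLeast {n | RamseyArrows (hedgehog t) 3 n} (ramseyNumber (hedgehog t) 3) :=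
  ⟨Nat.sInf_mem ⟨_, (isLeast_rainbowF (t ^ 3)).1.ramseyArrows ht le_rfl⟩,
    fun _ hn => Nat.sInf_le hn⟩

theorem ramseyNumber_hedgehog_le {t : ℕ} (ht : 1 ≤ t) :
    ramseyNumber (hedgehog t) 3 ≤ 1540 * (t ^ 2 * rainbowF (t ^ 3) ^ 2) := by
  have hF := (isLeast_rainbowF (t ^ 3)).1
  have htF : t ≤ rainbowF (t ^ 3) := (Nat.le_self_pow three_ne_zero t).trans hF.le
  have hpos : 0 < t ^ 2 * rainbowF (t ^ 3) ^ 2 :=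
    mul_pos (pow_pos ht 2) (pow_pos (ht.trans htF) 2)
  calc ramseyNumber (hedgehog t) 3
      ≤ 96 * t ^ 2 * (rainbowF (t ^ 3) + 3 * t) ^ 2 + 4 :=
        (isLeast_ramseyNumber_hedgehog ht).2 (hF.ramseyArrows ht le_rfl)
    _ ≤ 96 * t ^ 2 * (rainbowF (t ^ 3) + 3 * rainbowF (t ^ 3)) ^ 2 +
        4 * (t ^ 2 * rainbowF (t ^ 3) ^ 2) := by
        gcongr
        lia
    _ = 1540 * (t ^ 2 * rainbowF (t ^ 3) ^ 2) := by ring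

theorem ramseyNumber_hedgehog_le_two_pow {t k : ℕ} (ht : 1 ≤ t) (hk : 1 ≤ k) (htk : t ≤ 2 ^ k) :
    ramseyNumber (hedgehog t) 3 ≤ 2 ^ (229 * k ^ 2) := by
  have hF : rainbowF (t ^ 3) ≤ (6 * 2 ^ (9 * k)) ^ (9 * k) :=
    (isLeast_rainbowF _).2 <| rainbowOrClique_of_pow_le
      (calc (t ^ 3) ^ 3 ≤ ((2 ^ k) ^ 3) ^ 3 := by gcongr
        _ = 2 ^ (9 * k) := by ring) le_rfl
  calc ramseyNumber (hedgehog t) 3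
      ≤ 1540 * (t ^ 2 * rainbowF (t ^ 3) ^ 2) := ramseyNumber_hedgehog_le ht
    _ ≤ 2 ^ 11 * ((2 ^ k) ^ 2 * ((2 ^ 3 * 2 ^ (9 * k)) ^ (9 * k)) ^ 2) := by
        gcongr
        · norm_num
        · exact hF.trans (by gcongr; norm_num)
    _ = 2 ^ (11 + 56 * k + 162 * k ^ 2) := by
        simp only [← pow_mul, ← pow_add]
        congr 1
        ring
    _ ≤ 2 ^ (229 * k ^ 2) := Nat.pow_le_pow_right two_pos (by nlinarith)

theorem two_pow_mul_natLog_sq_le_rpow {t : ℕ} (ht : 1 ≤ t) (a : ℕ) :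
    (2 : ℝ) ^ (a * Nat.log 2 t ^ 2) ≤ (t : ℝ) ^ (2 * a * Real.log t) := by
  have htpos : (0 : ℝ) < t := by exact_mod_cast ht
  have hlog2 : 1 / 2 < Real.log 2 := by linarith [Real.log_two_gt_d9]
  have hlog : Nat.log 2 t * Real.log 2 ≤ Real.log t := by
    have hpow : (2 : ℝ) ^ Nat.log 2 t ≤ t := by exact_mod_cast Nat.pow_log_le_self 2 (by lia)
    simpa using Real.log_le_log (by positivity) hpow
  rw [← Real.log_le_log_iff (by positivity) (by positivity), Real.log_pow, Real.log_rpow htpos]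
  push_cast
  calc (a * (Nat.log 2 t) ^ 2 * Real.log 2 : ℝ)
      ≤ a * (Nat.log 2 t) ^ 2 * (2 * Real.log 2 ^ 2) := by gcongr; nlinarith
    _ = 2 * a * (Nat.log 2 t * Real.log 2) ^ 2 := by ring
    _ ≤ 2 * a * Real.log t ^ 2 := by gcongr
    _ = 2 * a * Real.log t * Real.log t := by ring

theorem ramseyArrows_hedgehog_one : RamseyArrows (hedgehog 1) 3 1 := by
  intro χ
  refine ⟨(Fintype.equivOfCardEq (by simp)).toEmbedding, 0, ?_⟩
  rintro _ ⟨p, rfl⟩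
  have hp := p.2 ▸ Finset.card_le_univ p.1
  simp at hp

theorem ramseyNumber_hedgehog_le_rpow {t : ℕ} (ht : 1 ≤ t) :
    (ramseyNumber (hedgehog t) 3 : ℝ) ≤ (t : ℝ) ^ (1832 * Real.log t) := by
  rcases ht.eq_or_lt with rfl | ht2
  · simpa using (isLeast_ramseyNumber_hedgehog le_rfl).2 ramseyArrows_hedgehog_one
  have hlog : 1 ≤ Nat.log 2 t := Nat.log_pos one_lt_two ht2
  have htlog : t ≤ 2 ^ (2 * Nat.log 2 t) :=
    (Nat.lt_pow_succ_log_self one_lt_two t).le.trans (Nat.pow_le_pow_right two_pos (by lia))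
  calc (ramseyNumber (hedgehog t) 3 : ℝ) ≤ 2 ^ (229 * (2 * Nat.log 2 t) ^ 2) := by
        exact_mod_cast ramseyNumber_hedgehog_le_two_pow ht (by lia) htlog
    _ = 2 ^ (916 * Nat.log 2 t ^ 2) := by ring_nf
    _ ≤ (t : ℝ) ^ (2 * (916 : ℕ) * Real.log t) := two_pow_mul_natLog_sq_le_rpow ht 916
    _ = (t : ℝ) ^ (1832 * Real.log t) := by norm_num

end Bounds

theorem theorem2 :
    -- the two minima that define the Ramsey number and `F` exist
    (∀ t : ℕ, 1 ≤ t →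
      IsLeast {n : ℕ | RamseyArrows (hedgehog t) 3 n} (ramseyNumber (hedgehog t) 3) ∧
      IsLeast {n : ℕ | RainbowOrClique t n} (rainbowF t)) ∧
    (∃ C : ℝ, 0 < C ∧ ∀ t : ℕ, 1 ≤ t →
      (ramseyNumber (hedgehog t) 3 : ℝ) ≤ C * ((t : ℝ) ^ 4 * (rainbowF (t ^ 3) : ℝ) ^ 2)) ∧
    (∀ t : ℕ, 1 ≤ t → rainbowF t ≤ ramseyNumber (hedgehog t) 3) ∧
    (∃ c : ℝ, 0 < c ∧ ∀ t : ℕ, 1 ≤ t →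
      (ramseyNumber (hedgehog t) 3 : ℝ) ≤ (t : ℝ) ^ (c * Real.log (t : ℝ))) := by
  refine ⟨fun t ht => ⟨isLeast_ramseyNumber_hedgehog ht, isLeast_rainbowF t⟩,
    ⟨1540, by norm_num, fun t ht => ?_⟩,
    fun t ht => (isLeast_rainbowF t).2 (isLeast_ramseyNumber_hedgehog ht).1.rainbowOrClique,
    ⟨1832, by norm_num, fun t ht => ramseyNumber_hedgehog_le_rpow ht⟩⟩
  calc (ramseyNumber (hedgehog t) 3 : ℝ)
      ≤ 1540 * ((t : ℝ) ^ 2 * (rainbowF (t ^ 3) : ℝ) ^ 2) := by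
        exact_mod_cast ramseyNumber_hedgehog_le ht
    _ ≤ 1540 * ((t : ℝ) ^ 4 * (rainbowF (t ^ 3) : ℝ) ^ 2) := by
        gcongr
        · exact_mod_cast ht
        · norm_num
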